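/- For $b\ge 0$, $\varepsilon>0$ let $k_{b,\varepsilon}(\mathbf w,\mathbf x)=\dfrac{(\mathbf w^\top\mathbf x+b)^2}{\|\mathbf x-\mathbf w\|^2+\varepsilon}$ on $\mathbb R^d\times\mathbb R^d$ (with the Euclidean norm); this is a positive semidefinite kernel, and for $S\subset\mathbb R^d$ let $\mathcal H_{b,\varepsilon}(S)$ be the reproducing kernel Hilbert space of its restriction to $S\times S$. Let $b_0>0$ and $\varepsilon_0>0$. Then: (i) For every compact $\mathcal X\subset\mathbb R^d$, $k_{b_0,\varepsilon_0}$ is characteristic on $\mathcal X$: the kernel mean embedding $\mu\mapsto\int k_{b_0,\varepsilon_0}(\cdot,\mathbf x)\,d\mu(\mathbf x)\in\mathcal H_{b_0,\varepsilon_0}(\mathcal X)$ is well defined and injective on the finite signed Borel measures on $\mathcal X$. Moreover the maximum mean discrepancy $$\mathrm{MMD}(P,Q)=\Big\|\int k_{b_0,\varepsilon_0}(\cdot,\mathbf x)\,dP(\mathbf x)-\int k_{b_0,\varepsilon_0}(\cdot,\mathbf x)\,dQ(\mathbf x)\Big\|_{\mathcal H_{b_0,\varepsilon_0}(\mathcal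 X)}$$ is a metric on the Borel probability measures on $\mathcal X$, and the topology it induces is the topology of weak convergence. (ii) $k_{b_0,\varepsilon_0}$ is strictly positive definite: for every $n$ and all pairwise distinct $\mathbf x_1,\dots,\mathbf x_n\in\mathbb R^d$, the Gram matrix $\mathbf K=(k_{b_0,\varepsilon_0}(\mathbf x_i,\mathbf x_j))_{i,j}$ is positive definite, hence invertible; and $\boldsymbol\alpha\mapsto\sqrt{\boldsymbol\alpha^\top\mathbf K\boldsymbol\alpha}$ is a norm on $\mathbb R^n$, equal to the RKHS norm $\big\|\sum_{j}\alpha_j k_{b_0,\varepsilon_0}(\cdot,\mathbf x_j)\big\|_{\mathcal H_{b_0,\varepsilon_0}(\mathbb R^d)}$. -/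

import Mathlib

open MeasureTheory
open scoped InnerProductSpace

noncomputable section

/-! ### The Yat kernel -/

/-- The Yat kernel `k_{b,ε}(w, x) = (wᵀx + b)² / (‖x - w‖² + ε)` on `ℝᵈ`. -/
def yatKernel {d : ℕ} (b ε : ℝ) (w x : EuclideanSpace ℝ (Fin d)) : ℝ :=
  (⟪w, x⟫_ℝ + b) ^ 2 / (‖x - w‖ ^ 2 + ε)

/-- The Gram matrix `(k (x i) (x j))ᵢⱼ` of a kernel at a finite family of points. -/
def gramMatrix {α ι : Type*} (k : α → α → ℝ) (x : ι → α) : Matrix ι ι ℝ :=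
  Matrix.of fun i j => k (x i) (x j)

/-- A real kernel, regarded as an operator-valued kernel (`k x y` acts on `ℝ` by multiplication),
which is the format of Mathlib's reproducing kernel Hilbert spaces. -/
def operatorKernel {α : Type*} (k : α → α → ℝ) : Matrix α α (ℝ →L[ℝ] ℝ) :=
  Matrix.of fun x y => k x y • ContinuousLinearMap.id ℝ ℝ

/-! ### Positive semidefiniteness, needed to construct the RKHS of the Yat kernel -/

/-- `k` is symmetric and positive semidefinite: its Gram matrix on every finite set of points is
(symmetric and) positive semidefinite. -/
def IsPSDKernel {α : Type*} (k : α → α → ℝ) : Prop :=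
  ∀ s : Finset α, (gramMatrix k (fun i : s => (i : α))).PosSemidef

theorem IsPSDKernel.mul {α : Type*} {k l : α → α → ℝ} (hk : IsPSDKernel k) (hl : IsPSDKernel l) :
    IsPSDKernel (fun x y => k x y * l x y) := by
  intro s
  exact (hk s).hadamard (hl s)

theorem isPSDKernel_inner {α V : Type*} [NormedAddCommGroup V] [InnerProductSpace ℝ V]
    (φ : α → V) : IsPSDKernel (fun x y => ⟪φ x, φ y⟫_ℝ) := by
  intro s
  refine Matrix.PosSemidef.of_dotProduct_mulVec_nonneg ?_ ?_
  · ext i j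
    simp [gramMatrix, real_inner_comm]
  · intro c
    have : star c ⬝ᵥ (gramMatrix (fun x y => ⟪φ x, φ y⟫_ℝ) (fun i : s => (i : α))).mulVec c
        = ⟪∑ i, c i • φ i, ∑ i, c i • φ i⟫_ℝ := by
      simp only [dotProduct, Matrix.mulVec, gramMatrix, Matrix.of_apply, sum_inner, inner_sum,
        inner_smul_left, inner_smul_right, Finset.mul_sum]
      refine Finset.sum_congr rfl fun i _ => Finset.sum_congr rfl fun j _ => ?_
      rw [real_inner_comm (φ i) (φ j)]
      simp only [star_trivial, conj_trivial]
      ring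
    rw [this]
    exact real_inner_self_nonneg

theorem isPSDKernel_const {α : Type*} {c : ℝ} (hc : 0 ≤ c) :
    IsPSDKernel (fun _ _ : α => c) := by
  have h := isPSDKernel_inner (fun _ : α => Real.sqrt c)
  have e : (fun _ _ : α => ⟪Real.sqrt c, Real.sqrt c⟫_ℝ) = fun _ _ => c := by
    funext x y
    simp [Real.sq_sqrt hc]
  rwa [e] at h

theorem IsPSDKernel.add {α : Type*} {k l : α → α → ℝ} (hk : IsPSDKernel k) (hl : IsPSDKernel l) :
    IsPSDKernel (fun x y => k x y + l x y) := by
  intro s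
  exact (hk s).add (hl s)

theorem IsPSDKernel.pow {α : Type*} {k : α → α → ℝ} (hk : IsPSDKernel k) (n : ℕ) :
    IsPSDKernel (fun x y => k x y ^ n) := by
  induction n with
  | zero => simpa using isPSDKernel_const (α := α) zero_le_one
  | succ n ih => simpa [pow_succ] using ih.mul hk

theorem IsPSDKernel.sum_range {α : Type*} {k : ℕ → α → α → ℝ} (hk : ∀ n, IsPSDKernel (k n))
    (N : ℕ) : IsPSDKernel (fun x y => ∑ n ∈ Finset.range N, k n x y) := by
  induction N with
  | zero => simpa using isPSDKernel_const (α := α) le_rfl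
  | succ n ih => simpa [Finset.sum_range_succ] using ih.add (hk n)

theorem IsPSDKernel.of_tendsto {α : Type*} {k : ℕ → α → α → ℝ} {l : α → α → ℝ}
    (hk : ∀ n, IsPSDKernel (k n))
    (hl : ∀ x y, Filter.Tendsto (fun n => k n x y) Filter.atTop (nhds (l x y))) :
    IsPSDKernel l := by
  intro s
  refine Matrix.PosSemidef.of_dotProduct_mulVec_nonneg ?_ ?_
  · ext i j
    have h1 := hl j i
    have h2 := hl i j
    have h3 : ∀ n, k n j i = k n i j := fun n => by
      have := congrFun (congrFun (hk n s).isHermitian i) j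
      simpa [gramMatrix] using this
    simp only [h3] at h1
    simpa [gramMatrix] using tendsto_nhds_unique h1 h2
  · intro c
    refine ge_of_tendsto' (x := Filter.atTop)
      (f := fun n => star c ⬝ᵥ (gramMatrix (k n) (fun i : s => (i : α))).mulVec c) ?_
      fun n => (hk n s).dotProduct_mulVec_nonneg c
    simp only [dotProduct, Matrix.mulVec, gramMatrix, Matrix.of_apply]
    exact tendsto_finsetSum _ fun i _ => Filter.Tendsto.const_mul _
      (tendsto_finsetSum _ fun j _ => (hl _ _).mul_const _)

/-- The inverse multiquadric kernel is positive semidefinite: after a Cayley transform of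
`‖x‖² + ε/2` it is a rescaled geometric series in an inner product kernel. -/
theorem isPSDKernel_imq {d : ℕ} {ε : ℝ} (hε : 0 < ε) :
    IsPSDKernel (fun w x : EuclideanSpace ℝ (Fin d) => (‖x - w‖ ^ 2 + ε)⁻¹) := by
  let v : EuclideanSpace ℝ (Fin d) → ℝ := fun x => 2 / (‖x‖ ^ 2 + ε / 2 + 1)
  have hv : ∀ x, 0 < v x := fun x => by positivity
  let φ : EuclideanSpace ℝ (Fin d) → WithLp 2 (ℝ × EuclideanSpace ℝ (Fin d)) :=
    fun x => WithLp.toLp 2 (1 - v x, v x • x)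
  have hφ : ∀ w x, ⟪φ w, φ x⟫_ℝ = (1 - v w) * (1 - v x) + v w * v x * ⟪w, x⟫_ℝ := fun w x => by
    simp [φ, inner_smul_left, inner_smul_right]
    ring
  have key : ∀ w x, 1 - ⟪φ w, φ x⟫_ℝ = v w * v x / 2 * (‖x - w‖ ^ 2 + ε) := fun w x => by
    have e1 : v w * (‖w‖ ^ 2 + ε / 2 + 1) = 2 := by
      simp only [v]
      field_simp
    have e2 : v x * (‖x‖ ^ 2 + ε / 2 + 1) = 2 := by
      simp only [v]
      field_simp
    rw [hφ, norm_sub_sq_real, real_inner_comm w x]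
    linear_combination (-(v x) / 2) * e1 + (-(v w) / 2) * e2
  have hlt : ∀ x, ‖φ x‖ < 1 := fun x => by
    have h := key x x
    rw [real_inner_self_eq_norm_sq] at h
    have : 0 < v x * v x / 2 * (‖x - x‖ ^ 2 + ε) := by
      have := hv x
      positivity
    nlinarith [norm_nonneg (φ x)]
  have habs : ∀ w x, |⟪φ w, φ x⟫_ℝ| < 1 := fun w x => by
    have h1 := abs_real_inner_le_norm (φ w) (φ x)
    nlinarith [norm_nonneg (φ w), norm_nonneg (φ x), hlt w, hlt x]
  have hgeo : IsPSDKernel (fun w x => (1 - ⟪φ w, φ x⟫_ℝ)⁻¹) :=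
    IsPSDKernel.of_tendsto (fun N => IsPSDKernel.sum_range (fun n => (isPSDKernel_inner φ).pow n) N)
      fun w x => (hasSum_geometric_of_abs_lt_one (habs w x)).tendsto_sum_nat
  have hfac : IsPSDKernel (fun w x => ⟪v w, v x⟫_ℝ) := isPSDKernel_inner v
  have hall := (hfac.mul hgeo).mul (isPSDKernel_const (c := 1 / 2) (by norm_num))
  convert hall using 3 with w x
  have h1 := hv w
  have h2 := hv x
  have h3 : 0 < ‖x - w‖ ^ 2 + ε := by positivity
  rw [key]
  simp only [RCLike.inner_apply]
  simp
  field_simp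

theorem isPSDKernel_yatKernel {d : ℕ} {b ε : ℝ} (hb : 0 ≤ b) (hε : 0 < ε) :
    IsPSDKernel (yatKernel b ε (d := d)) := by
  have h := (((isPSDKernel_inner (id : EuclideanSpace ℝ (Fin d) → _)).add
    (isPSDKernel_const hb)).pow 2).mul (isPSDKernel_imq hε)
  exact h

theorem IsPSDKernel.posSemidef_operatorKernel {α : Type*} {k : α → α → ℝ} (hk : IsPSDKernel k) :
    (operatorKernel k).PosSemidef := by
  refine ((RKHS.posSemidef_tfae (K := operatorKernel k)).out 0 2).2 ?_
  have hsymm : ∀ x y, k x y = k y x := fun x y => by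
    classical
    have := congrFun (congrFun (hk {x, y}).isHermitian ⟨y, by simp⟩) ⟨x, by simp⟩
    simpa [gramMatrix] using this
  refine ⟨?_, fun c => ?_⟩
  · ext x y
    have hid : ContinuousLinearMap.adjoint (ContinuousLinearMap.id ℝ ℝ) =
        ContinuousLinearMap.id ℝ ℝ := ContinuousLinearMap.adjoint_id
    simp [operatorKernel, hsymm x y, ContinuousLinearMap.star_eq_adjoint, hid]
  · have h := (hk c.support).dotProduct_mulVec_nonneg (fun i => c i)
    simp only [dotProduct, Matrix.mulVec, gramMatrix, Matrix.of_apply, Finset.mul_sum] at h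
    have h' : 0 ≤ ∑ i ∈ c.support, ∑ j ∈ c.support, c i * (k i j * c j) := by
      rw [← Finset.sum_coe_sort]
      exact h.trans_eq (Finset.sum_congr rfl fun i _ =>
        Finset.sum_coe_sort c.support (fun j => c i * (k i j * c j)))
    convert h' using 1
    simp only [Finsupp.sum, operatorKernel]
    simp
    refine Finset.sum_congr rfl fun i _ => Finset.sum_congr rfl fun j _ => ?_
    rw [hsymm j i]
    ring

theorem IsPSDKernel.comp {α β : Type*} {k : α → α → ℝ} (hk : IsPSDKernel k) (f : β → α) :
    IsPSDKernel (fun x y => k (f x) (f y)) := by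
  classical
  intro s
  exact (hk (s.image f)).submatrix
    (fun i : s => (⟨f i, Finset.mem_image_of_mem f i.2⟩ : (s.image f : Finset α)))

/-- The restriction of a kernel to a set `X`. -/
def restrictKernel {α : Type*} (k : α → α → ℝ) (X : Set α) (x y : X) : ℝ := k x y

theorem IsPSDKernel.restrict {α : Type*} {k : α → α → ℝ} (hk : IsPSDKernel k) (X : Set α) :
    IsPSDKernel (restrictKernel k X) :=
  hk.comp Subtype.val

/-! ### The RKHS of a positive semidefinite kernel -/

/-- The reproducing kernel Hilbert space `H_k` of a positive semidefinite kernel `k` on `α`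
(Moore--Aronszajn): a Hilbert space of functions `α → ℝ` with reproducing kernel `k`. -/
def KernelRKHS {α : Type*} (k : α → α → ℝ) (hk : IsPSDKernel k) : Type _ :=
  haveI : Fact (operatorKernel k).PosSemidef := ⟨hk.posSemidef_operatorKernel⟩
  RKHS.OfKernel (operatorKernel k)

instance {α : Type*} (k : α → α → ℝ) (hk : IsPSDKernel k) :
    NormedAddCommGroup (KernelRKHS k hk) :=
  haveI : Fact (operatorKernel k).PosSemidef := ⟨hk.posSemidef_operatorKernel⟩
  inferInstanceAs (NormedAddCommGroup (RKHS.OfKernel (operatorKernel k)))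

instance {α : Type*} (k : α → α → ℝ) (hk : IsPSDKernel k) :
    InnerProductSpace ℝ (KernelRKHS k hk) :=
  haveI : Fact (operatorKernel k).PosSemidef := ⟨hk.posSemidef_operatorKernel⟩
  inferInstanceAs (InnerProductSpace ℝ (RKHS.OfKernel (operatorKernel k)))

instance {α : Type*} (k : α → α → ℝ) (hk : IsPSDKernel k) :
    CompleteSpace (KernelRKHS k hk) :=
  haveI : Fact (operatorKernel k).PosSemidef := ⟨hk.posSemidef_operatorKernel⟩
  inferInstanceAs (CompleteSpace (RKHS.OfKernel (operatorKernel k)))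

instance {α : Type*} (k : α → α → ℝ) (hk : IsPSDKernel k) :
    RKHS ℝ (KernelRKHS k hk) α ℝ :=
  haveI : Fact (operatorKernel k).PosSemidef := ⟨hk.posSemidef_operatorKernel⟩
  inferInstanceAs (RKHS ℝ (RKHS.OfKernel (operatorKernel k)) α ℝ)

/-- The section `k(·, x)` as an element of `H_k`. -/
def kernelSection {α : Type*} (k : α → α → ℝ) (hk : IsPSDKernel k) (x : α) : KernelRKHS k hk :=
  RKHS.kerFun (KernelRKHS k hk) x 1

theorem kernelSection_apply {α : Type*} (k : α → α → ℝ) (hk : IsPSDKernel k) (x y : α) :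
    kernelSection k hk x y = k y x := by
  have : Fact (operatorKernel k).PosSemidef := ⟨hk.posSemidef_operatorKernel⟩
  have h : RKHS.kernel (KernelRKHS k hk) = operatorKernel k :=
    RKHS.OfKernel.kernel_ofKernel (K := operatorKernel k)
  rw [kernelSection, RKHS.kerFun_apply, h]
  simp [operatorKernel]

/-- The reproducing property. -/
theorem inner_kernelSection {α : Type*} (k : α → α → ℝ) (hk : IsPSDKernel k) (x : α)
    (f : KernelRKHS k hk) : ⟪f, kernelSection k hk x⟫_ℝ = f x := by
  simp [kernelSection]

/-! ### Mean embeddings, MMD, characteristic and strictly positive definite kernels -/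

/-- The kernel mean embedding `μ ↦ ∫ k(·, x) dμ(x) ∈ H_k` of finite signed measures, as an
`H_k`-valued Bochner integral. -/
def meanEmbedding {α : Type*} [MeasurableSpace α] (k : α → α → ℝ) (hk : IsPSDKernel k)
    (μ : SignedMeasure α) : KernelRKHS k hk :=
  VectorMeasure.integral μ (fun x => kernelSection k hk x) (ContinuousLinearMap.lsmul ℝ ℝ).flip

/-- `k` is characteristic: the kernel mean embedding is defined on all finite signed measures
(the integrals converge) and it is injective there. -/
def IsCharacteristic {α : Type*} [MeasurableSpace α] (k : α → α → ℝ) (hk : IsPSDKernel k) : Prop :=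
  (∀ μ : SignedMeasure α, VectorMeasure.Integrable μ (fun x => kernelSection k hk x)) ∧
    Function.Injective (meanEmbedding k hk)

/-- The maximum mean discrepancy `MMD_k(P, Q) = ‖∫ k(·, x) dP(x) - ∫ k(·, x) dQ(x)‖_{H_k}`. -/
def mmd {α : Type*} [MeasurableSpace α] (k : α → α → ℝ) (hk : IsPSDKernel k)
    (P Q : ProbabilityMeasure α) : ℝ :=
  ‖meanEmbedding k hk (P : Measure α).toSignedMeasure -
    meanEmbedding k hk (Q : Measure α).toSignedMeasure‖

/-- The topology of weak convergence on the Borel probability measures (Mathlib's instance). -/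
abbrev weakConvergenceTopology (α : Type*) [MeasurableSpace α] [TopologicalSpace α]
    [OpensMeasurableSpace α] : TopologicalSpace (ProbabilityMeasure α) :=
  inferInstance

/-- `D` metrizes weak convergence: `D` is a metric on the Borel probability measures whose
topology is the topology of weak convergence. -/
def MetrizesWeakConvergence {α : Type*} [MeasurableSpace α] [TopologicalSpace α]
    [OpensMeasurableSpace α] (D : ProbabilityMeasure α → ProbabilityMeasure α → ℝ) : Prop :=
  ∃ m : MetricSpace (ProbabilityMeasure α),
    (∀ P Q, m.dist P Q = D P Q) ∧
    m.toUniformSpace.toTopologicalSpace = weakConvergenceTopology α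

/-- `k` is strictly positive definite: the Gram matrix at any finitely many pairwise distinct
points is positive definite. -/
def IsStrictlyPosDefKernel {α : Type*} (k : α → α → ℝ) : Prop :=
  ∀ (n : ℕ) (x : Fin n → α), Function.Injective x → (gramMatrix k x).PosDef

end

open Filter
open scoped Topology

/-! ### Functions in the RKHS -/

/-! Everything follows from universality: on a compact space embedded in `ℝᵈ`, the continuous
functions in the RKHS are uniformly dense.

Universality rests on a domination criterion, `exists_kernelRKHS_apply_eq`: if `k - g ⊗ g` is
positive semidefinite, then `g ∈ H_k`. The Yat kernel dominates `b²` times the inverse multiquadric,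
which is `v ⊗ v / 2` times the geometric series in `q`, where `v` is `stereoFactor` and `q` is
`stereoKernel`. A monomial of degree `n` in the stereographic coordinates is dominated by `qⁿ`, so
`v` times it lies in the RKHS. The coordinates separate points, so Stone–Weierstrass applies, and
multiplication by the positive `v` preserves density.

Pairing with `f ∈ H_k` turns mean embeddings into integrals of `f`, and density extends these to all
continuous test functions. This gives injectivity and the topology of MMD; strict positive
definiteness is universality on a finite discrete space. -/

theorem isPSDKernel_mul_self {α : Type*} (g : α → ℝ) : IsPSDKernel (fun x y => g x * g y) := by
  have h := isPSDKernel_inner g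
  have e : (fun x y => ⟪g x, g y⟫_ℝ) = fun x y => g x * g y := by
    funext x y
    simp [mul_comm]
  rwa [e] at h

theorem IsPSDKernel.nonneg_finsuppSum {α : Type*} {k : α → α → ℝ} (hk : IsPSDKernel k)
    (c : α →₀ ℝ) : 0 ≤ ∑ x ∈ c.support, ∑ y ∈ c.support, c x * c y * k x y := by
  have h := (hk c.support).dotProduct_mulVec_nonneg (fun i => c i)
  simp only [dotProduct, Matrix.mulVec, gramMatrix, Matrix.of_apply, Finset.mul_sum] at h
  refine h.trans_eq ?_
  rw [← Finset.sum_coe_sort c.support (fun x => ∑ y ∈ c.support, c x * c y * k x y)]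
  refine Finset.sum_congr rfl fun i _ => ?_
  rw [← Finset.sum_coe_sort c.support (fun y => c i * c y * k i y)]
  refine Finset.sum_congr rfl fun j _ => ?_
  simp only [star_trivial]
  ring

theorem inner_kernelSection_kernelSection {α : Type*} (k : α → α → ℝ) (hk : IsPSDKernel k)
    (x y : α) : ⟪kernelSection k hk x, kernelSection k hk y⟫_ℝ = k y x := by
  rw [inner_kernelSection, kernelSection_apply]

theorem IsPSDKernel.symm {α : Type*} {k : α → α → ℝ} (hk : IsPSDKernel k) (x y : α) :
    k x y = k y x := by
  rw [← inner_kernelSection_kernelSection k hk x y, real_inner_comm,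
    inner_kernelSection_kernelSection]

theorem norm_sq_sum_smul_kernelSection {α ι : Type*} (k : α → α → ℝ) (hk : IsPSDKernel k)
    (s : Finset ι) (c : ι → ℝ) (x : ι → α) :
    ‖∑ i ∈ s, c i • kernelSection k hk (x i)‖ ^ 2 =
      ∑ i ∈ s, ∑ j ∈ s, c i * c j * k (x i) (x j) := by
  rw [← real_inner_self_eq_norm_sq, sum_inner]
  refine Finset.sum_congr rfl fun i _ => ?_
  rw [inner_sum]
  refine Finset.sum_congr rfl fun j _ => ?_
  rw [inner_smul_left, inner_smul_right, inner_kernelSection_kernelSection, hk.symm]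
  simp [mul_assoc]

/-- A function `g` for which `k - g ⊗ g` is positive semidefinite belongs to `H_k`. -/
theorem exists_kernelRKHS_apply_eq {α : Type*} (k : α → α → ℝ) (hk : IsPSDKernel k) (g : α → ℝ)
    (hg : IsPSDKernel (fun x y => k x y - g x * g y)) :
    ∃ f : KernelRKHS k hk, ∀ x, f x = g x := by
  let S : (α →₀ ℝ) →ₗ[ℝ] KernelRKHS k hk := Finsupp.linearCombination ℝ (kernelSection k hk)
  let G : (α →₀ ℝ) →ₗ[ℝ] ℝ := Finsupp.linearCombination ℝ g
  -- Positivity of `k - g ⊗ g` at the coefficients `c` is exactly this bound. Hence `G` factors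
  -- through the range of `S` as a functional of norm at most 1; Hahn–Banach and Riesz then
  -- represent it.
  have hle : ∀ c, |G c| ≤ ‖S c‖ := fun c => by
    refine abs_le_of_sq_le_sq ?_ (norm_nonneg _)
    have h1 : ‖S c‖ ^ 2 = ∑ x ∈ c.support, ∑ y ∈ c.support, c x * c y * k x y := by
      simp only [S, Finsupp.linearCombination_apply, Finsupp.sum]
      exact norm_sq_sum_smul_kernelSection k hk c.support c id
    have h2 : G c ^ 2 = ∑ x ∈ c.support, ∑ y ∈ c.support, c x * c y * (g x * g y) := by
      simp only [G, Finsupp.linearCombination_apply, Finsupp.sum, smul_eq_mul, sq,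
        Finset.sum_mul_sum]
      refine Finset.sum_congr rfl fun x _ => Finset.sum_congr rfl fun y _ => ?_
      ring
    have h3 := hg.nonneg_finsuppSum c
    simp only [mul_sub, Finset.sum_sub_distrib] at h3
    linarith
  obtain ⟨R, hR⟩ := S.rangeRestrict.exists_rightInverse_of_surjective S.range_rangeRestrict
  have hSR : ∀ y, S (R y) = y := fun y => congrArg Subtype.val (LinearMap.congr_fun hR y)
  have hS : ∀ c, (S.rangeRestrict c : KernelRKHS k hk) = S c := fun _ => rfl
  have hGR : ∀ c, G (R (S.rangeRestrict c)) = G c := fun c => by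
    have h := hle (R (S.rangeRestrict c) - c)
    rw [map_sub, map_sub, hSR, hS, sub_self, norm_zero] at h
    exact sub_eq_zero.1 (abs_eq_zero.1 (le_antisymm h (abs_nonneg _)))
  let l : StrongDual ℝ (LinearMap.range S) := (G ∘ₗ R).mkContinuous 1 fun y => by
    simpa [hSR] using hle (R y)
  obtain ⟨L, hL, -⟩ := exists_extension_norm_eq (LinearMap.range S) l
  refine ⟨(InnerProductSpace.toDual ℝ _).symm L, fun x => ?_⟩
  rw [← inner_kernelSection k hk, InnerProductSpace.toDual_symm_apply]
  have h1 : S (Finsupp.single x 1) = kernelSection k hk x := by simp [S]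
  have h2 : G (Finsupp.single x 1) = g x := by simp [G]
  have h3 := hL (S.rangeRestrict (Finsupp.single x 1))
  rw [hS, h1] at h3
  rw [h3, ← h2]
  exact hGR _

theorem inner_sum_smul_kernelSection {α ι : Type*} (k : α → α → ℝ) (hk : IsPSDKernel k)
    (s : Finset ι)
    (c : ι → ℝ) (x : ι → α) (f : KernelRKHS k hk) :
    ⟪f, ∑ i ∈ s, c i • kernelSection k hk (x i)⟫_ℝ = ∑ i ∈ s, c i * f (x i) := by
  simp only [inner_sum, inner_smul_right, inner_kernelSection]

/-- The continuous functions that belong to `H_k`. -/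
def continuousKernelRKHS {α : Type*} [TopologicalSpace α] (k : α → α → ℝ) (hk : IsPSDKernel k) :
    Submodule ℝ C(α, ℝ) where
  carrier := {g | ∃ f : KernelRKHS k hk, ∀ x, f x = g x}
  add_mem' := by
    rintro g h ⟨f, hf⟩ ⟨f', hf'⟩
    exact ⟨f + f', fun x => by simp [hf, hf']⟩
  zero_mem' := ⟨0, fun x => by simp⟩
  smul_mem' := by
    rintro c g ⟨f, hf⟩
    exact ⟨c • f, fun x => by simp [hf]⟩

/-- `k` is universal: the continuous functions in `H_k` are dense. -/
def IsUniversalKernel {α : Type*} [TopologicalSpace α] (k : α → α → ℝ) (hk : IsPSDKernel k) :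
    Prop :=
  Dense (continuousKernelRKHS k hk : Set C(α, ℝ))

/-! ### Strict positive definiteness -/

theorem gramMatrix_quadraticForm {α : Type*} (k : α → α → ℝ) (hk : IsPSDKernel k) {n : ℕ}
    (x : Fin n → α) (c : Fin n → ℝ) :
    c ⬝ᵥ (gramMatrix k x).mulVec c = ‖∑ i, c i • kernelSection k hk (x i)‖ ^ 2 := by
  rw [norm_sq_sum_smul_kernelSection]
  simp only [dotProduct, Matrix.mulVec, gramMatrix, Matrix.of_apply, Finset.mul_sum]
  refine Finset.sum_congr rfl fun i _ => Finset.sum_congr rfl fun j _ => ?_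
  ring

/-- If the quadratic form vanishes at `c`, then `∑ cᵢ k(·, i) = 0`, so `∑ cᵢ f(i) = 0` for every `f`
in the RKHS. Density extends this to all functions on `Fin n`, in particular to `c` itself. -/
theorem posDef_gramMatrix_of_isUniversalKernel {n : ℕ} (k : Fin n → Fin n → ℝ)
    (hk : IsPSDKernel k) (hd : IsUniversalKernel k hk) : (gramMatrix k id).PosDef := by
  refine Matrix.PosDef.of_dotProduct_mulVec_pos ?_ fun c hc => ?_
  · ext i j
    simp [gramMatrix, hk.symm i j]
  rw [star_trivial, gramMatrix_quadraticForm k hk]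
  refine lt_of_le_of_ne (sq_nonneg _) fun h => hc ?_
  have h0 : ∑ i, c i • kernelSection k hk (id i) = 0 := by
    simpa using h.symm
  have hcl : IsClosed {g : C(Fin n, ℝ) | ∑ i, c i * g i = 0} :=
    isClosed_eq (continuous_finsetSum _ fun i _ => continuous_const.mul
      (continuous_eval_const i)) continuous_const
  have hsub : (continuousKernelRKHS k hk : Set C(Fin n, ℝ)) ⊆ {g | ∑ i, c i * g i = 0} := by
    rintro g ⟨f, hf⟩
    have := inner_sum_smul_kernelSection k hk Finset.univ c id f
    rw [h0, inner_zero_right] at this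
    simpa [hf] using this.symm
  have hmem := hcl.closure_subset_iff.2 hsub
    (hd (⟨c, continuous_of_discreteTopology⟩ : C(Fin n, ℝ)))
  have hsum : ∑ i, c i * c i = 0 := hmem
  rw [Finset.sum_eq_zero_iff_of_nonneg fun i _ => mul_self_nonneg _] at hsum
  funext i
  simpa using hsum i (Finset.mem_univ i)

/-! ### Mean embeddings for continuous kernels on compact spaces -/

theorem continuous_kernelSection {α : Type*} [TopologicalSpace α] {k : α → α → ℝ}
    (hk : IsPSDKernel k) (hc : Continuous (Function.uncurry k)) :
    Continuous (kernelSection k hk) := by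
  rw [continuous_iff_continuousAt]
  intro x
  rw [ContinuousAt, tendsto_iff_norm_sub_tendsto_zero]
  have e : ∀ y, ‖kernelSection k hk y - kernelSection k hk x‖ =
      √(k y y - 2 * k x y + k x x) := fun y => by
    have h := norm_sub_sq_real (kernelSection k hk y) (kernelSection k hk x)
    rw [← real_inner_self_eq_norm_sq (kernelSection k hk y),
      ← real_inner_self_eq_norm_sq (kernelSection k hk x)] at h
    simp only [inner_kernelSection_kernelSection] at h
    rw [← h, Real.sqrt_sq (norm_nonneg _)]
  simp only [e]
  have h : Continuous fun y => √(k y y - 2 * k x y + k x x) := by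
    have h1 : Continuous fun y => k y y := hc.comp (continuous_id.prodMk continuous_id)
    have h2 : Continuous fun y => k x y := hc.comp (continuous_const.prodMk continuous_id)
    fun_prop
  have h' := h.tendsto x
  have z : k x x - 2 * k x x + k x x = 0 := by ring
  rwa [z, Real.sqrt_zero] at h'

/-- Integrability against a signed measure means integrability against its variation; this bound
reduces it to finite positive measures. -/
theorem variation_le_posPart_add_negPart {α : Type*} [MeasurableSpace α] (μ : SignedMeasure α) :
    μ.variation ≤ μ.toJordanDecomposition.posPart + μ.toJordanDecomposition.negPart := by
  conv_lhs => rw [← μ.toSignedMeasure_toJordanDecomposition, JordanDecomposition.toSignedMeasure]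
  refine VectorMeasure.variation_sub_le.trans ?_
  simp

theorem meanEmbedding_toSignedMeasure {α : Type*} [MeasurableSpace α] {k : α → α → ℝ}
    (hk : IsPSDKernel k) (μ : Measure α) [IsFiniteMeasure μ] :
    meanEmbedding k hk μ.toSignedMeasure = ∫ x, kernelSection k hk x ∂μ :=
  VectorMeasure.integral_toSignedMeasure

section

variable {α : Type*} [TopologicalSpace α] [CompactSpace α] [SecondCountableTopology α]
  [MeasurableSpace α] [BorelSpace α]

theorem Continuous.integrable_of_compactSpace {F : Type*} [NormedAddCommGroup F] {f : α → F}
    (hf : Continuous f) (μ : Measure α) [IsFiniteMeasure μ] : Integrable f μ := by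
  obtain ⟨C, hC⟩ := (isCompact_range hf).isBounded.exists_norm_le
  exact Integrable.of_bound hf.aestronglyMeasurable C
    (Eventually.of_forall fun x => hC _ (Set.mem_range_self x))

theorem Continuous.vectorMeasure_integrable {F : Type*} [NormedAddCommGroup F] {f : α → F}
    (hf : Continuous f) (μ : SignedMeasure α) : VectorMeasure.Integrable μ f :=
  (hf.integrable_of_compactSpace _).mono_measure (variation_le_posPart_add_negPart μ)

variable {k : α → α → ℝ} (hk : IsPSDKernel k)

theorem meanEmbedding_eq_sub (hc : Continuous (Function.uncurry k)) (μ : SignedMeasure α) :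
    meanEmbedding k hk μ = ∫ x, kernelSection k hk x ∂μ.toJordanDecomposition.posPart -
      ∫ x, kernelSection k hk x ∂μ.toJordanDecomposition.negPart := by
  have h := continuous_kernelSection hk hc
  conv_lhs => rw [← μ.toSignedMeasure_toJordanDecomposition, JordanDecomposition.toSignedMeasure]
  rw [meanEmbedding, VectorMeasure.integral_sub_vectorMeasure (h.vectorMeasure_integrable _)
    (h.vectorMeasure_integrable _)]
  congr 1 <;> exact meanEmbedding_toSignedMeasure hk _

theorem inner_integral_kernelSection (hc : Continuous (Function.uncurry k)) (μ : Measure α)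
    [IsFiniteMeasure μ] (f : KernelRKHS k hk) :
    ⟪f, ∫ x, kernelSection k hk x ∂μ⟫_ℝ = ∫ x, f x ∂μ := by
  rw [← integral_inner ((continuous_kernelSection hk hc).integrable_of_compactSpace μ)]
  simp only [inner_kernelSection]

theorem continuous_integral_continuousMap (μ : Measure α) [IsFiniteMeasure μ] :
    Continuous fun g : C(α, ℝ) => ∫ x, g x ∂μ :=
  (LipschitzWith.of_dist_le_mul (K := ⟨μ.real Set.univ, measureReal_nonneg⟩) fun g h => by
    rw [dist_eq_norm, ← integral_sub (g.continuous.integrable_of_compactSpace μ)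
      (h.continuous.integrable_of_compactSpace μ), mul_comm]
    exact norm_integral_le_of_norm_le_const (Eventually.of_forall fun x => by
      rw [← dist_eq_norm]
      exact ContinuousMap.dist_apply_le_dist x)).continuous

/-- Pairing with RKHS elements shows that the two integrals agree on a dense set of continuous
functions. Both are continuous in the uniform norm, and finite measures are determined by such
integrals. -/
theorem measure_eq_of_integral_kernelSection_eq [HasOuterApproxClosed α]
    (hc : Continuous (Function.uncurry k))
    (hd : IsUniversalKernel k hk) (μ ν : Measure α) [IsFiniteMeasure μ] [IsFiniteMeasure ν]
    (h : ∫ x, kernelSection k hk x ∂μ = ∫ x, kernelSection k hk x ∂ν) : μ = ν := by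
  refine ext_of_forall_integral_eq_of_IsFiniteMeasure fun g => ?_
  have hcl := isClosed_eq (continuous_integral_continuousMap μ)
    (continuous_integral_continuousMap ν)
  refine hcl.closure_subset_iff.2 ?_ (hd g.toContinuousMap)
  rintro g ⟨f, hf⟩
  have := inner_integral_kernelSection hk hc μ f
  rw [h, inner_integral_kernelSection hk hc ν f] at this
  simpa [hf] using this.symm

theorem isCharacteristic_of_isUniversalKernel [HasOuterApproxClosed α]
    (hc : Continuous (Function.uncurry k)) (hd : IsUniversalKernel k hk) :
    IsCharacteristic k hk := by
  refine ⟨fun μ => (continuous_kernelSection hk hc).vectorMeasure_integrable μ, fun μ ν h => ?_⟩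
  have hi := fun μ : Measure α => fun [IsFiniteMeasure μ] =>
    (continuous_kernelSection hk hc).integrable_of_compactSpace μ
  -- Moving the negative parts across, `μ⁺ + ν⁻` and `ν⁺ + μ⁻` are positive measures with the same
  -- embedding.
  rw [meanEmbedding_eq_sub hk hc, meanEmbedding_eq_sub hk hc, sub_eq_sub_iff_add_eq_add,
    ← integral_add_measure (hi _) (hi _), ← integral_add_measure (hi _) (hi _)] at h
  have h' := measure_eq_of_integral_kernelSection_eq hk hc hd _ _ h
  have h'' := Measure.toSignedMeasure_congr h'
  rw [Measure.toSignedMeasure_add, Measure.toSignedMeasure_add, ← sub_eq_sub_iff_add_eq_add] at h''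
  rw [← μ.toSignedMeasure_toJordanDecomposition, ← ν.toSignedMeasure_toJordanDecomposition]
  exact h''

/-- The mean embedding of probability measures is continuous for weak convergence. -/
theorem continuous_integral_kernelSection (hc : Continuous (Function.uncurry k)) :
    Continuous fun P : ProbabilityMeasure α => ∫ x, kernelSection k hk x ∂(P : Measure α) := by
  have hs := continuous_kernelSection hk hc
  -- Pairings with fixed `f` only give weak convergence in `H_k`. Compactness of this hull, which
  -- contains all the embeddings, upgrades it to norm convergence: every cluster point is identified
  -- by its pairings.
  have hcomp : IsCompact (closedConvexHull ℝ (Set.range (kernelSection k hk))) := by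
    rw [closedConvexHull_eq_closure_convexHull]
    exact (isCompact_range hs).totallyBounded.convexHull.closure.isCompact_of_isClosed
      isClosed_closure
  rw [continuous_iff_continuousAt]
  intro P
  refine hcomp.tendsto_nhds_of_unique_mapClusterPt (Eventually.of_forall fun Q => ?_)
    fun y _ hy => ?_
  · exact convex_closedConvexHull.integral_mem isClosed_closedConvexHull
      (Eventually.of_forall fun x => subset_closedConvexHull (Set.mem_range_self x))
      (hs.integrable_of_compactSpace _)
  · refine ext_inner_left ℝ fun f => ?_
    have hf : Continuous fun x => f x := by
      simp only [← inner_kernelSection]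
      fun_prop
    have h1 : MapClusterPt ⟪f, y⟫_ℝ (𝓝 P)
        (fun Q => ⟪f, ∫ x, kernelSection k hk x ∂(Q : Measure α)⟫_ℝ) :=
      hy.continuousAt_comp (f := fun y => ⟪f, y⟫_ℝ) (by fun_prop)
    have h2 : Tendsto (fun Q : ProbabilityMeasure α =>
        ⟪f, ∫ x, kernelSection k hk x ∂(Q : Measure α)⟫_ℝ) (𝓝 P)
        (𝓝 ⟪f, ∫ x, kernelSection k hk x ∂(P : Measure α)⟫_ℝ) := by
      simp only [inner_integral_kernelSection hk hc]
      exact (ProbabilityMeasure.tendsto_iff_forall_integral_tendsto.1 tendsto_id)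
        (BoundedContinuousFunction.mkOfCompact ⟨_, hf⟩)
    exact t2_iff_nhds.1 inferInstance (h1.clusterPt.mono h2)

/-- Convergence of embeddings gives convergence of `∫ f` for `f ∈ H_k`. A general `g` is uniformly
`δ / 3`-close to such an `f`, and probability measures have mass 1. -/
theorem isInducing_integral_kernelSection
    (hc : Continuous (Function.uncurry k)) (hd : IsUniversalKernel k hk) :
    Topology.IsInducing fun P : ProbabilityMeasure α =>
      ∫ x, kernelSection k hk x ∂(P : Measure α) := by
  rw [Topology.isInducing_iff_nhds]
  intro P
  refine le_antisymm ((continuous_integral_kernelSection hk hc).tendsto P).le_comap ?_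
  refine tendsto_id'.1 ?_
  refine ProbabilityMeasure.tendsto_iff_forall_integral_tendsto.2 fun g => ?_
  have key : ∀ f : KernelRKHS k hk, Tendsto
      (fun Q : ProbabilityMeasure α => ∫ x, f x ∂(Q : Measure α))
      (comap (fun P : ProbabilityMeasure α => ∫ x, kernelSection k hk x ∂(P : Measure α))
        (𝓝 (∫ x, kernelSection k hk x ∂(P : Measure α)))) (𝓝 (∫ x, f x ∂(P : Measure α))) := by
    intro f
    simp only [← inner_integral_kernelSection hk hc]
    exact ((continuous_const.inner continuous_id).tendsto _).comp tendsto_comap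
  rw [Metric.tendsto_nhds]
  intro δ hδ
  obtain ⟨h, hh, ⟨f, hf⟩⟩ := Metric.dense_iff.1 hd g.toContinuousMap (δ / 3) (by positivity)
  have hh' : ∀ x, |g x - h x| < δ / 3 := fun x => by
    have := (ContinuousMap.dist_lt_iff (by positivity)).1 hh x
    rwa [dist_comm, Real.dist_eq] at this
  have hI : ∀ Q : ProbabilityMeasure α,
      |∫ x, g x ∂(Q : Measure α) - ∫ x, h x ∂(Q : Measure α)| ≤ δ / 3 := fun Q => by
    rw [← integral_sub (g.continuous.integrable_of_compactSpace _)
      (h.continuous.integrable_of_compactSpace _), ← Real.norm_eq_abs]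
    simpa using norm_integral_le_of_norm_le_const (μ := (Q : Measure α))
      (f := fun x => g x - h x) (Eventually.of_forall fun x => (hh' x).le)
  filter_upwards [Metric.tendsto_nhds.1 (key f) (δ / 3) (by positivity)] with Q hQ
  simp only [hf, Real.dist_eq] at hQ ⊢
  have h1 := abs_le.1 (hI Q)
  have h2 := abs_le.1 (hI P)
  have h3 := abs_lt.1 hQ
  exact abs_lt.2 ⟨by simp only [id]; linarith, by simp only [id]; linarith⟩

theorem metrizesWeakConvergence_mmd [HasOuterApproxClosed α]
    (hc : Continuous (Function.uncurry k)) (hd : IsUniversalKernel k hk) :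
    MetrizesWeakConvergence (mmd k hk) := by
  have hinj : Function.Injective
      fun P : ProbabilityMeasure α => ∫ x, kernelSection k hk x ∂(P : Measure α) := fun P Q h =>
    Subtype.ext (measure_eq_of_integral_kernelSection_eq hk hc hd P Q h)
  refine ⟨MetricSpace.induced _ hinj inferInstance, fun P Q => ?_, ?_⟩
  · rw [mmd, meanEmbedding_toSignedMeasure, meanEmbedding_toSignedMeasure, ← dist_eq_norm]
    rfl
  · exact (isInducing_integral_kernelSection hk hc hd).eq_induced.symm

end

/-! ### Universality of the Yat kernel -/

/-- If `m (1 - q) = p` and `qⁿ - g ⊗ g` is positive semidefinite, then so is `m - p (g ⊗ g)`. -/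
theorem IsPSDKernel.sub_mul_of_geometric {α : Type*} {m p q : α → α → ℝ} (hm : IsPSDKernel m)
    (hp : IsPSDKernel p) (hq : IsPSDKernel q) (hmpq : ∀ x y, m x y * (1 - q x y) = p x y) {n : ℕ}
    {g : α → ℝ} (hg : IsPSDKernel fun x y => q x y ^ n - g x * g y) :
    IsPSDKernel fun x y => m x y - p x y * (g x * g y) := by
  -- The finite geometric sum gives `m = m qⁿ⁺¹ + p ∑_{i ≤ n} qⁱ`; `p (g ⊗ g)` is subtracted from
  -- the term `i = n`.
  have h := ((hm.mul (hq.pow (n + 1))).add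
    (hp.mul (IsPSDKernel.sum_range (fun i => hq.pow i) n))).add (hp.mul hg)
  convert h using 3 with x y
  have h1 := mul_neg_geom_sum (q x y) (n + 1)
  rw [Finset.sum_range_succ] at h1
  rw [← hmpq]
  linear_combination -(m x y) * h1

theorem IsPSDKernel.pow_sub_mul_of_mem_closure {α : Type*} [TopologicalSpace α] {q : α → α → ℝ}
    (hq : IsPSDKernel q) {s : Set C(α, ℝ)}
    (hs : ∀ g ∈ s, IsPSDKernel fun x y => q x y - g x * g y) {g : C(α, ℝ)}
    (hg : g ∈ Submonoid.closure s) : ∃ n : ℕ, IsPSDKernel fun x y => q x y ^ n - g x * g y := by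
  induction hg using Submonoid.closure_induction with
  | mem g hg => exact ⟨1, by simpa using hs g hg⟩
  | one => exact ⟨0, by simpa using isPSDKernel_const (α := α) le_rfl⟩
  | mul g h _ _ hg hh =>
    obtain ⟨n, hn⟩ := hg
    obtain ⟨m, hm⟩ := hh
    refine ⟨n + m, ?_⟩
    -- `qⁿ⁺ᵐ - gh ⊗ gh = (qⁿ - g ⊗ g) qᵐ + (g ⊗ g)(qᵐ - h ⊗ h)`.
    convert (hn.mul (hq.pow m)).add ((isPSDKernel_mul_self g).mul hm) using 3 with x y
    simp only [ContinuousMap.mul_apply, pow_add]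
    ring

/-- This is the inner product of the vectors with their `i`-th coordinate removed. -/
theorem isPSDKernel_inner_sub_coord {d : ℕ} (i : Fin d) :
    IsPSDKernel fun w x : EuclideanSpace ℝ (Fin d) => ⟪w, x⟫_ℝ - w i * x i := by
  convert isPSDKernel_inner
    fun w : EuclideanSpace ℝ (Fin d) => w - w i • EuclideanSpace.single i (1 : ℝ) using 3 with w x
  simp [inner_sub_left, inner_sub_right, inner_smul_left, inner_smul_right,
    EuclideanSpace.inner_single_left, EuclideanSpace.inner_single_right]

/-! ### Stereographic coordinates and Stone–Weierstrass -/

section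

variable {d : ℕ} {Y : Type*} [TopologicalSpace Y]

/-- The conformal factor of the inverse stereographic projection, after rescaling. -/
noncomputable def stereoFactor (ε : ℝ) (x : EuclideanSpace ℝ (Fin d)) : ℝ :=
  2 / (‖x‖ ^ 2 + ε / 2 + 1)

theorem stereoFactor_pos {ε : ℝ} (hε : 0 < ε) (x : EuclideanSpace ℝ (Fin d)) :
    0 < stereoFactor ε x := by
  unfold stereoFactor
  positivity

theorem continuous_stereoFactor {ε : ℝ} (hε : 0 < ε) :
    Continuous (stereoFactor ε : EuclideanSpace ℝ (Fin d) → ℝ) :=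
  Continuous.div₀ (by fun_prop) (by fun_prop) fun x => by positivity

/-- The inner product of the inverse stereographic projections of two points. -/
noncomputable def stereoKernel (ε : ℝ) (w x : EuclideanSpace ℝ (Fin d)) : ℝ :=
  (1 - stereoFactor ε w) * (1 - stereoFactor ε x) +
    stereoFactor ε w * stereoFactor ε x * ⟪w, x⟫_ℝ

theorem isPSDKernel_stereoKernel (ε : ℝ) : IsPSDKernel (stereoKernel (d := d) ε) :=
  (isPSDKernel_mul_self _).add ((isPSDKernel_mul_self _).mul (isPSDKernel_inner id))

/-- The shifts `ε / 2` at the two points add up to the `ε` of the kernel. -/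
theorem imq_mul_one_sub_stereoKernel {ε : ℝ} (hε : 0 < ε) (w x : EuclideanSpace ℝ (Fin d)) :
    (‖x - w‖ ^ 2 + ε)⁻¹ * (1 - stereoKernel ε w x) = stereoFactor ε w * stereoFactor ε x / 2 := by
  have e1 : stereoFactor ε w * (‖w‖ ^ 2 + ε / 2 + 1) = 2 := by
    unfold stereoFactor
    field_simp
  have e2 : stereoFactor ε x * (‖x‖ ^ 2 + ε / 2 + 1) = 2 := by
    unfold stereoFactor
    field_simp
  have h : 0 < ‖x - w‖ ^ 2 + ε := by positivity
  rw [inv_mul_eq_iff_eq_mul₀ h.ne', stereoKernel, norm_sub_sq_real, real_inner_comm w x]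
  linear_combination (-(stereoFactor ε x) / 2) * e1 + (-(stereoFactor ε w) / 2) * e2

/-- The coordinates of the inverse stereographic projection along `f`. -/
noncomputable def stereoCoordinates {ε : ℝ} (hε : 0 < ε) (f : C(Y, EuclideanSpace ℝ (Fin d))) :
    Set C(Y, ℝ) :=
  insert ⟨fun y => 1 - stereoFactor ε (f y),
      continuous_const.sub ((continuous_stereoFactor hε).comp f.continuous)⟩
    (Set.range fun i : Fin d => ⟨fun y => stereoFactor ε (f y) * f y i,
      ((continuous_stereoFactor hε).comp f.continuous).mul (by fun_prop)⟩)

/-- The first coordinate determines the conformal factor, which is positive and so cancels from the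
others. -/
theorem separatesPoints_adjoin_stereoCoordinates {ε : ℝ} (hε : 0 < ε)
    (f : C(Y, EuclideanSpace ℝ (Fin d))) (hf : Function.Injective f) :
    (Algebra.adjoin ℝ (stereoCoordinates hε f)).SeparatesPoints := by
  intro x y hxy
  by_contra! h
  have h' : ∀ g ∈ stereoCoordinates hε f, g x = g y := fun g hg =>
    h g ⟨g, Algebra.subset_adjoin hg, rfl⟩
  refine hxy (hf (PiLp.ext fun i => ?_))
  have h1 : 1 - stereoFactor ε (f x) = 1 - stereoFactor ε (f y) := h' _ (Set.mem_insert _ _)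
  have h2 : stereoFactor ε (f x) * f x i = stereoFactor ε (f y) * f y i :=
    h' _ (Set.mem_insert_of_mem _ ⟨i, rfl⟩)
  rw [← sub_right_inj.1 h1] at h2
  exact mul_left_cancel₀ (stereoFactor_pos hε _).ne' h2

theorem isPSDKernel_stereoKernel_sub_mul {ε : ℝ} (hε : 0 < ε)
    (f : C(Y, EuclideanSpace ℝ (Fin d))) :
    ∀ g ∈ stereoCoordinates hε f,
      IsPSDKernel fun x y => stereoKernel ε (f x) (f y) - g x * g y := by
  rintro g (rfl | ⟨i, rfl⟩)
  · convert ((isPSDKernel_mul_self (stereoFactor ε)).mul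
      (isPSDKernel_inner (id : EuclideanSpace ℝ (Fin d) → _))).comp f using 3 with x y
    simp [stereoKernel]
  · convert ((isPSDKernel_mul_self fun x => 1 - stereoFactor ε x).add
      ((isPSDKernel_mul_self (stereoFactor ε)).mul (isPSDKernel_inner_sub_coord i))).comp f
      using 3 with x y
    simp only [stereoKernel, ContinuousMap.coe_mk]
    ring

/-- Expanding the square leaves `⟪w, x⟫² + 2b ⟪w, x⟫` times the inverse multiquadric, a product of
positive semidefinite kernels. -/
theorem isPSDKernel_yatKernel_sub_imq {b ε : ℝ} (hb : 0 ≤ b) (hε : 0 < ε) :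
    IsPSDKernel fun w x : EuclideanSpace ℝ (Fin d) =>
      yatKernel b ε w x - b ^ 2 * (‖x - w‖ ^ 2 + ε)⁻¹ := by
  have hi := isPSDKernel_inner (id : EuclideanSpace ℝ (Fin d) → _)
  convert ((hi.pow 2).add (hi.mul (isPSDKernel_const (c := 2 * b) (by positivity)))).mul
    (isPSDKernel_imq hε) using 3 with w x
  simp only [yatKernel, id]
  ring

/-- On a compact space that embeds into `ℝᵈ` the Yat kernel is universal. -/
theorem isUniversalKernel_yatKernel_comp [CompactSpace Y] {b ε : ℝ} (hb : 0 < b) (hε : 0 < ε)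
    (f : C(Y, EuclideanSpace ℝ (Fin d))) (hf : Function.Injective f) :
    IsUniversalKernel (fun x y => yatKernel b ε (f x) (f y))
      ((isPSDKernel_yatKernel hb.le hε).comp f) := by
  -- The constant makes `v ⊗ v` equal to `b²` times the numerator `stereoFactor ⊗ stereoFactor / 2`
  -- of the geometric series.
  let v : C(Y, ℝ) := ⟨fun y => b / √2 * stereoFactor ε (f y),
    continuous_const.mul ((continuous_stereoFactor hε).comp f.continuous)⟩
  have hv : ∀ y, 0 < v y := fun y => mul_pos (by positivity) (stereoFactor_pos hε _)
  have hdense : Dense (Algebra.adjoin ℝ (stereoCoordinates hε f) : Set C(Y, ℝ)) := by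
    rw [dense_iff_closure_eq, ← Subalgebra.topologicalClosure_coe,
      ContinuousMap.subalgebra_topologicalClosure_eq_top_of_separatesPoints _
        (separatesPoints_adjoin_stereoCoordinates hε f hf)]
    rfl
  have hsurj : Function.Surjective fun g : C(Y, ℝ) => v * g := fun g =>
    ⟨⟨fun y => (v y)⁻¹ * g y, (v.continuous.inv₀ fun y => (hv y).ne').mul g.continuous⟩, by
      ext y
      simp [(hv y).ne']⟩
  refine (hsurj.denseRange.dense_image (continuous_const.mul continuous_id) hdense).mono ?_
  rintro _ ⟨g, hg, rfl⟩
  rw [SetLike.mem_coe, ← Subalgebra.mem_toSubmodule, Algebra.adjoin_eq_span] at hg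
  -- The adjoined algebra is spanned by monomials and membership in the RKHS is linear, so monomials
  -- suffice.
  refine Submodule.span_le (p := (continuousKernelRKHS (fun x y => yatKernel b ε (f x) (f y))
    ((isPSDKernel_yatKernel hb.le hε).comp f)).comap (LinearMap.mulLeft ℝ v)) |>.2 ?_ hg
  intro g hg
  obtain ⟨n, hn⟩ := ((isPSDKernel_stereoKernel ε).comp f).pow_sub_mul_of_mem_closure
    (isPSDKernel_stereoKernel_sub_mul hε f) hg
  refine exists_kernelRKHS_apply_eq _ _ _ ?_
  have hp := ((isPSDKernel_mul_self (stereoFactor (d := d) ε)).mul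
    (isPSDKernel_const (c := 1 / 2) (by norm_num))).comp f
  have h := IsPSDKernel.sub_mul_of_geometric ((isPSDKernel_imq hε).comp f) hp
    ((isPSDKernel_stereoKernel ε).comp f)
    (fun x y => by rw [imq_mul_one_sub_stereoKernel hε]; ring) hn
  -- With `m` the inverse multiquadric and `p = stereoFactor ⊗ stereoFactor / 2`, the difference is
  -- `(k - b² m) + b² (m - p (g ⊗ g))`.
  convert ((isPSDKernel_yatKernel_sub_imq hb.le hε).comp f).add
    ((isPSDKernel_const (sq_nonneg b)).mul h) using 3 with x y
  have h2 : (√2)⁻¹ * (√2)⁻¹ = (1 / 2 : ℝ) := by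
    rw [← mul_inv, Real.mul_self_sqrt (by norm_num)]
    norm_num
  simp only [LinearMap.mulLeft_apply, ContinuousMap.mul_apply, v, ContinuousMap.coe_mk]
  linear_combination (-(b ^ 2 * stereoFactor ε (f x) * stereoFactor ε (f y) * g x * g y)) * h2

theorem continuous_restrictKernel_yatKernel {b ε : ℝ} (hε : 0 < ε)
    (X : Set (EuclideanSpace ℝ (Fin d))) :
    Continuous (Function.uncurry (restrictKernel (yatKernel b ε) X)) := by
  refine Continuous.div₀
    (f := fun p : X × X => (⟪(p.1 : EuclideanSpace ℝ (Fin d)), p.2⟫_ℝ + b) ^ 2)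
    (g := fun p : X × X => ‖(p.2 : EuclideanSpace ℝ (Fin d)) - p.1‖ ^ 2 + ε)
    (by fun_prop) (by fun_prop) fun p => by positivity

theorem isUniversalKernel_restrictKernel_yatKernel {b ε : ℝ} (hb : 0 < b) (hε : 0 < ε)
    {X : Set (EuclideanSpace ℝ (Fin d))} (hX : IsCompact X) :
    IsUniversalKernel (restrictKernel (yatKernel b ε) X)
      ((isPSDKernel_yatKernel hb.le hε).restrict X) :=
  have : CompactSpace X := isCompact_iff_compactSpace.1 hX
  isUniversalKernel_yatKernel_comp hb hε ⟨Subtype.val, continuous_subtype_val⟩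
    Subtype.val_injective

end

/-- Distinct points embed the compact discrete space `Fin n` into `ℝᵈ`, where universality applies
to the pulled-back kernel. -/
theorem isStrictlyPosDefKernel_yatKernel {d : ℕ} {b ε : ℝ} (hb : 0 < b) (hε : 0 < ε) :
    IsStrictlyPosDefKernel (yatKernel b ε (d := d)) := fun _ x hx =>
  posDef_gramMatrix_of_isUniversalKernel _ _
    (isUniversalKernel_yatKernel_comp hb hε ⟨x, continuous_of_discreteTopology⟩ hx)

theorem corollary4 {d : ℕ} {b₀ ε₀ : ℝ} (hb : 0 < b₀) (hε : 0 < ε₀) :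
    (∀ X : Set (EuclideanSpace ℝ (Fin d)), IsCompact X →
      IsCharacteristic (restrictKernel (yatKernel b₀ ε₀) X)
        ((isPSDKernel_yatKernel hb.le hε).restrict X) ∧
      MetrizesWeakConvergence
        (mmd (restrictKernel (yatKernel b₀ ε₀) X)
          ((isPSDKernel_yatKernel hb.le hε).restrict X))) ∧
    IsStrictlyPosDefKernel (yatKernel b₀ ε₀ (d := d)) ∧
    ∀ (n : ℕ) (x : Fin n → EuclideanSpace ℝ (Fin d)), Function.Injective x →
      IsUnit (gramMatrix (yatKernel b₀ ε₀) x) ∧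
      ∃ N : Seminorm ℝ (Fin n → ℝ),
        (∀ α, N α ^ 2 = α ⬝ᵥ (gramMatrix (yatKernel b₀ ε₀) x).mulVec α) ∧
        (∀ α, N α = ‖∑ j, α j • kernelSection (yatKernel b₀ ε₀)
          (isPSDKernel_yatKernel hb.le hε) (x j)‖) ∧
        (∀ α, N α = 0 → α = 0) := by
  have hspd := isStrictlyPosDefKernel_yatKernel (d := d) hb hε
  have hk := isPSDKernel_yatKernel (d := d) hb.le hε
  refine ⟨fun X hX => ?_, hspd, fun n x hx => ⟨(hspd n x hx).isUnit, ?_⟩⟩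
  · have : CompactSpace X := isCompact_iff_compactSpace.1 hX
    have hc := continuous_restrictKernel_yatKernel (b := b₀) hε X
    have hd := isUniversalKernel_restrictKernel_yatKernel hb hε hX
    exact ⟨isCharacteristic_of_isUniversalKernel _ hc hd, metrizesWeakConvergence_mmd _ hc hd⟩
  -- The RKHS norm pulled back along `α ↦ ∑ αⱼ k(·, xⱼ)` is automatically a seminorm; positive
  -- definiteness of the Gram matrix makes it a norm.
  · let N : Seminorm ℝ (Fin n → ℝ) := (normSeminorm ℝ _).comp
      (Fintype.linearCombination ℝ fun j => kernelSection (yatKernel b₀ ε₀) hk (x j))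
    have hN : ∀ α, N α = ‖∑ j, α j • kernelSection (yatKernel b₀ ε₀) hk (x j)‖ := fun α => rfl
    have hN2 : ∀ α, N α ^ 2 = α ⬝ᵥ (gramMatrix (yatKernel b₀ ε₀) x).mulVec α := fun α => by
      rw [hN, gramMatrix_quadraticForm]
    refine ⟨N, hN2, hN, fun α hα => ?_⟩
    by_contra hne
    have h := (hspd n x hx).dotProduct_mulVec_pos hne
    rw [star_trivial, ← hN2, hα] at h
    norm_num at h
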